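/- Let $X$ be a reflexive real Banach space with topological dual $X^{*}$. For a multi-valued operator $T:X\rightrightarrows X^{*}$ (i.e. a map assigning to each $x\in X$ a possibly empty subset $T(x)\subset X^{*}$) let $D(T):=\{x\in X\mid T(x)\neq\emptyset\}$ be its domain. The operator $T$ is called monotone if $(x_1^{*}-x_2^{*})(x_1-x_2)\ge 0$ for all $x_1,x_2\in X$, $x_1^{*}\in T(x_1)$, $x_2^{*}\in T(x_2)$; and maximal monotone if it is monotone and every $(x,x^{*})\in X\times X^{*}$ such that $(x^{*}-a^{*})(x-a)\ge 0$ for all $a\in X$, $a^{*}\in T(a)$ satisfies $x^{*}\in T(x)$. Let $A,B:X\rightrightarrows X^{*}$ be maximal monotone operators such that $D(A)\cap\operatorname{int}D(B)\neq\emptyset$, where $\operatorname{int}$ denotes the interior in the norm topology of $X$. Then the operator $A+B:X\rightrightarrows X^{*}$, $(A+B)(x):=A(x)+B(x)=\{a^{*}+b^{*}\mid a^{*}\in A(x),\ b^{*}\in B(x)\}$, is maximal monotone. -/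

import Mathlib

open scoped Pointwise

namespace MultiOp

variable {X : Type*} [NormedAddCommGroup X] [NormedSpace ℝ X]

/-- The domain `D(T) = {x | T(x) ≠ ∅}` of a multi-valued operator `T : X ⇉ X*`. -/
def dom (T : X → Set (StrongDual ℝ X)) : Set X :=
  {x | (T x).Nonempty}

/-- The graph of a multi-valued operator `T : X ⇉ X*`. -/
def graph (T : X → Set (StrongDual ℝ X)) : Set (X × StrongDual ℝ X) :=
  {z | z.2 ∈ T z.1}

/-- `T` is monotone: `⟨x₁ - x₂, x₁* - x₂*⟩ ≥ 0` for all `x₁* ∈ T x₁`, `x₂* ∈ T x₂`. -/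
def IsMonotone (T : X → Set (StrongDual ℝ X)) : Prop :=
  ∀ x₁ x₂ : X, ∀ f₁ ∈ T x₁, ∀ f₂ ∈ T x₂, 0 ≤ (f₁ - f₂) (x₁ - x₂)

/-- `z = (x, x*)` is monotonically related to `T`: `⟨x - a, x* - a*⟩ ≥ 0` for every
`(a, a*)` in the graph of `T`. -/
def IsMonotonicallyRelated (T : X → Set (StrongDual ℝ X)) (z : X × StrongDual ℝ X) : Prop :=
  ∀ w ∈ graph T, 0 ≤ (z.2 - w.2) (z.1 - w.1)

/-- `T` is maximal monotone: it is monotone, and its graph contains every pair that is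
monotonically related to `T`. -/
def IsMaximalMonotone (T : X → Set (StrongDual ℝ X)) : Prop :=
  IsMonotone T ∧ ∀ z : X × StrongDual ℝ X, IsMonotonicallyRelated T z → z ∈ graph T

end MultiOp

/-- A real normed space is reflexive if the canonical embedding into its bidual is onto. -/
def IsReflexiveSpace (X : Type*) [NormedAddCommGroup X] [NormedSpace ℝ X] : Prop :=
  Function.Surjective (NormedSpace.inclusionInDoubleDual ℝ X)

/-! If `(z, k)` is monotonically related to `A + B`, translate the graphs to move it to the origin
and find a zero `x` of `A + B + J`, `J` the duality mapping. Relatedness gives `0 ≤ (f + g) x`,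
while `J` bounds it by `-(‖x‖² + ‖f + g‖²) / 2`; so both vanish and `(z, k)` is in the graph.

The zero comes from Fenchel duality. Fitzpatrick functions are convex and dominate the pairing, so
`F_A (x, f) + F_B (x, g) + ‖x‖² / 2 + ‖f + g‖² / 2 ≥ 0`. Separation yields multipliers; reflexivity
turns the one on `X*` into a point, and maximality makes the dual inequalities tight. Local
boundedness of `B` at the interior point supplies the constraint qualification. -/

namespace MultiOp

variable {X : Type*} [NormedAddCommGroup X] [NormedSpace ℝ X]

/-! ### Fitzpatrick functions and local boundedness -/

/-- The epigraph of the Fitzpatrick function of `T`. -/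
def fitzpatrickEpigraph (T : X → Set (StrongDual ℝ X)) : Set (X × StrongDual ℝ X × ℝ) :=
  {z | ∀ a, ∀ f ∈ T a, f z.1 + z.2.1 a - f a ≤ z.2.2}

theorem convex_fitzpatrickEpigraph (T : X → Set (StrongDual ℝ X)) :
    Convex ℝ (fitzpatrickEpigraph T) := by
  rintro ⟨x, f, r⟩ hx ⟨y, g, s⟩ hy α β hα hβ hαβ a h ha
  have h1 := mul_le_mul_of_nonneg_left (hx a h ha) hα
  have h2 := mul_le_mul_of_nonneg_left (hy a h ha) hβ
  have h3 : h a = α * h a + β * h a := by rw [← add_mul, hαβ, one_mul]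
  simp only [Prod.fst_add, Prod.snd_add, Prod.smul_fst, Prod.smul_snd, map_add, map_smul,
    smul_eq_mul, add_apply, smul_apply] at h1 h2 ⊢
  linarith

theorem IsMonotone.mem_fitzpatrickEpigraph {T : X → Set (StrongDual ℝ X)} (hT : IsMonotone T)
    {x : X} {f : StrongDual ℝ X} (hf : f ∈ T x) : (x, f, f x) ∈ fitzpatrickEpigraph T := by
  intro a g hg
  have := hT x a f hf g hg
  simp only [map_sub, sub_apply] at this ⊢
  linarith

/-- The Fitzpatrick function of a maximal monotone operator dominates the duality pairing,
strictly so outside the graph. -/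
theorem IsMaximalMonotone.exists_apply_le {T : X → Set (StrongDual ℝ X)}
    (hT : IsMaximalMonotone T) (x : X) (f : StrongDual ℝ X) :
    ∃ a, ∃ g ∈ T a, f x ≤ g x + f a - g a ∧ (f ∉ T x → f x < g x + f a - g a) := by
  by_cases hf : f ∈ T x
  · exact ⟨x, f, hf, by linarith, fun h => absurd hf h⟩
  · have h : ¬ IsMonotonicallyRelated T (x, f) := fun h => hf (hT.2 _ h)
    unfold IsMonotonicallyRelated at h
    push Not at h
    obtain ⟨⟨a, g⟩, hg, h⟩ := h
    simp only [map_sub, sub_apply] at h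
    exact ⟨a, g, hg, by linarith, fun _ => by linarith⟩

theorem IsMaximalMonotone.apply_le_of_mem_fitzpatrickEpigraph {T : X → Set (StrongDual ℝ X)}
    (hT : IsMaximalMonotone T) {x : X} {f : StrongDual ℝ X} {r : ℝ}
    (h : (x, f, r) ∈ fitzpatrickEpigraph T) : f x ≤ r := by
  obtain ⟨a, g, hg, h1, -⟩ := hT.exists_apply_le x f
  exact h1.trans (h a g hg)

/-- A monotone operator on a Banach space is locally bounded on the interior of its domain. -/
theorem IsMonotone.exists_norm_le_of_mem_interior_dom [CompleteSpace X]
    {T : X → Set (StrongDual ℝ X)} (hT : IsMonotone T) {a : X} (ha : a ∈ interior (dom T)) :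
    ∃ δ > 0, ∃ M, ∀ y ∈ Metric.ball a δ, ∀ f ∈ T y, ‖f‖ ≤ M := by
  obtain ⟨ε, hε, hball⟩ := Metric.mem_nhds_iff.1 (mem_interior_iff_mem_nhds.1 ha)
  let ι := {z : X × StrongDual ℝ X // z.2 ∈ T z.1 ∧ ‖z.1 - a‖ ≤ 1}
  -- Monotonicity bounds `f w` only up to the term `‖f‖ * ‖y - a‖`; dividing by this weight makes
  -- the family pointwise bounded.
  let c : ι → ℝ := fun i => 1 + ‖i.1.2‖ * ‖i.1.1 - a‖
  have hc : ∀ i, 1 ≤ c i := fun i => le_add_of_nonneg_right (by positivity)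
  have key : ∀ w : X, ‖w‖ < ε → ∃ C, ∀ i : ι, i.1.2 w ≤ C * c i := by
    intro w hw
    obtain ⟨g, hg⟩ : (T (a + w)).Nonempty := hball (by simpa using hw)
    refine ⟨1 + ‖g‖ * (1 + ‖w‖), fun i => ?_⟩
    obtain ⟨⟨y, f⟩, hf, hy⟩ := i
    have h1 := hT y (a + w) f hf g hg
    have h2 : f (y - a) ≤ ‖f‖ * ‖y - a‖ := (le_abs_self _).trans (f.le_opNorm _)
    have h3 : -g (y - a - w) ≤ ‖g‖ * (1 + ‖w‖) := by
      refine (neg_le_abs _).trans ((g.le_opNorm _).trans ?_)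
      gcongr
      exact (norm_sub_le _ _).trans (by gcongr)
    have h4 : f w ≤ ‖f‖ * ‖y - a‖ + ‖g‖ * (1 + ‖w‖) := by
      simp only [map_sub, map_add, sub_apply] at h1 h2 h3
      linarith
    have h5 : 0 ≤ ‖g‖ * (1 + ‖w‖) * (‖f‖ * ‖y - a‖) := by positivity
    change f w ≤ (1 + ‖g‖ * (1 + ‖w‖)) * (1 + ‖f‖ * ‖y - a‖)
    linarith
  obtain ⟨K, hK⟩ := banach_steinhaus (g := fun i : ι => (c i)⁻¹ • i.1.2) (by
    intro w
    obtain ⟨t, ht, htw⟩ : ∃ t : ℝ, 0 < t ∧ ‖t • w‖ < ε := by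
      refine ⟨ε / (‖w‖ + 1), by positivity, ?_⟩
      rw [norm_smul, Real.norm_of_nonneg (by positivity), div_mul_eq_mul_div,
        div_lt_iff₀ (by positivity)]
      nlinarith
    obtain ⟨C, hC⟩ := key _ htw
    obtain ⟨C', hC'⟩ := key (-(t • w)) (by rwa [norm_neg])
    refine ⟨max C C' / t, fun i => ?_⟩
    have hci : 0 < c i := one_pos.trans_le (hc i)
    have h1 := hC i
    have h2 := hC' i
    simp only [map_neg, map_smul, smul_eq_mul] at h1 h2
    rw [smul_apply, smul_eq_mul, norm_mul, norm_inv,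
      Real.norm_of_nonneg hci.le, inv_mul_le_iff₀ hci, mul_div_assoc', le_div_iff₀ ht,
      Real.norm_eq_abs, mul_comm, ← abs_of_pos ht, ← abs_mul, mul_comm (c i)]
    refine abs_le'.2 ⟨h1.trans ?_, h2.trans ?_⟩
    · gcongr; exact le_max_left _ _
    · gcongr; exact le_max_right _ _)
  have hK0 : 0 < |K| + 1 := by positivity
  -- On this radius the weight contributes at most `‖f‖ / 2`, which the left side absorbs.
  refine ⟨min 1 (1 / (2 * (|K| + 1))), by positivity, 2 * (|K| + 1), fun y hy f hf => ?_⟩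
  rw [mem_ball_iff_norm, lt_min_iff, lt_div_iff₀ (by positivity)] at hy
  have h := hK ⟨(y, f), hf, hy.1.le⟩
  have hci : 0 < c ⟨(y, f), hf, hy.1.le⟩ := one_pos.trans_le (hc _)
  rw [norm_smul, norm_inv, Real.norm_of_nonneg hci.le, inv_mul_le_iff₀ hci] at h
  have h1 : ‖f‖ ≤ (1 + ‖f‖ * ‖y - a‖) * (|K| + 1) :=
    h.trans (by gcongr; exact (le_abs_self K).trans (by linarith))
  have h2 : ‖f‖ * (‖y - a‖ * (2 * (|K| + 1))) ≤ ‖f‖ * 1 := by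
    gcongr; exact hy.2.le
  linarith

end MultiOp

/-! ### Separation and the half squared norm -/

/-- If a convex set in `E × ℝ` contains a neighbourhood of some `(0, T)` and meets the line
`{0} × ℝ` only at nonnegative heights, then it lies above a hyperplane through the origin. -/
theorem Convex.exists_strongDual_add_nonneg {E : Type*} [NormedAddCommGroup E] [NormedSpace ℝ E]
    {C : Set (E × ℝ)} (hC : Convex ℝ C) {T : ℝ} (hT : ((0 : E), T) ∈ interior C)
    (h0 : ∀ t, ((0 : E), t) ∈ C → 0 ≤ t) :
    ∃ g : StrongDual ℝ E, ∀ e t, (e, t) ∈ C → 0 ≤ t + g e := by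
  have hnot : ((0 : E), (0 : ℝ)) ∉ interior C := by
    intro h
    have hcont : Filter.Tendsto (fun t : ℝ => ((0 : E), t)) (nhds 0) (nhds (0, 0)) :=
      (Continuous.prodMk continuous_const continuous_id).tendsto _
    obtain ⟨ε, hε, hb⟩ := Metric.mem_nhds_iff.1 (hcont (mem_interior_iff_mem_nhds.1 h))
    have : (-(ε / 2) : ℝ) ∈ Metric.ball (0 : ℝ) ε := by
      rw [mem_ball_zero_iff, norm_neg, Real.norm_of_nonneg (by positivity)]
      linarith
    have := h0 _ (hb this)
    linarith
  obtain ⟨f, hf⟩ := geometric_hahn_banach_open_point hC.interior isOpen_interior hnot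
  have hf0 : f ((0 : E), (0 : ℝ)) = 0 := map_zero f
  have hfC : ∀ z ∈ C, f z ≤ 0 := by
    intro z hz
    have hz' : z ∈ closure (interior C) := by
      rw [hC.closure_interior_eq_closure_of_nonempty_interior ⟨_, hT⟩]
      exact subset_closure hz
    refine closure_minimal (fun w hw => ?_) (isClosed_le f.continuous continuous_const) hz'
    exact hf0 ▸ (hf w hw).le
  have hdec : ∀ (e : E) (t : ℝ), f (e, t) = f (e, 0) + t * f (0, 1) := by
    intro e t
    rw [← smul_eq_mul, ← map_smul, ← map_add]
    simp
  -- The hyperplane is not vertical, since `T ≥ 0` and `T * f (0, 1) < 0`.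
  have hτ : f ((0 : E), (1 : ℝ)) < 0 := by
    have h1 := hf _ hT
    rw [hdec, hf0, zero_add] at h1
    have h2 := h0 T (interior_subset hT)
    by_contra h
    nlinarith
  refine ⟨(f ((0 : E), (1 : ℝ)))⁻¹ • f.comp (ContinuousLinearMap.inl ℝ E ℝ), fun e t het => ?_⟩
  have h := hfC _ het
  rw [hdec] at h
  have h1 := mul_nonneg_of_nonpos_of_nonpos (inv_nonpos.2 hτ.le) h
  rw [mul_add, mul_comm t, inv_mul_cancel_left₀ hτ.ne] at h1
  simp only [smul_apply, ContinuousLinearMap.comp_apply,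
    ContinuousLinearMap.inl_apply, smul_eq_mul]
  linarith

/-- The conjugate of `‖·‖² / 2` is at least `‖·‖² / 2`. -/
theorem StrongDual.half_sq_norm_le {E : Type*} [NormedAddCommGroup E] [NormedSpace ℝ E]
    (f : StrongDual ℝ E) {c : ℝ} (h : ∀ u, f u - ‖u‖ ^ 2 / 2 ≤ c) : ‖f‖ ^ 2 / 2 ≤ c := by
  have hc : 0 ≤ c := by simpa using h 0
  have hf : ‖f‖ ≤ √(2 * c) := by
    refine f.opNorm_le_bound (Real.sqrt_nonneg _) fun u => ?_
    have hq : ∀ t : ℝ, 0 ≤ ‖u‖ ^ 2 * (t * t) + (-2 * f u) * t + 2 * c := by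
      intro t
      have := h (t • u)
      rw [map_smul, smul_eq_mul, norm_smul, mul_pow, Real.norm_eq_abs, sq_abs] at this
      linarith
    have hd := discrim_le_zero hq
    rw [discrim] at hd
    rw [Real.norm_eq_abs]
    refine abs_le_of_sq_le_sq (a := f u) ?_ (by positivity)
    rw [mul_pow, Real.sq_sqrt (by positivity)]
    linarith
  have := pow_le_pow_left₀ (norm_nonneg f) hf 2
  rw [Real.sq_sqrt (by positivity)] at this
  linarith

theorem StrongDual.neg_half_sq_norm_add_le {E : Type*} [NormedAddCommGroup E] [NormedSpace ℝ E]
    (f : StrongDual ℝ E) (x : E) : -(‖x‖ ^ 2 / 2 + ‖f‖ ^ 2 / 2) ≤ f x := by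
  have h := (neg_le_abs (f x)).trans (f.le_opNorm x)
  nlinarith [sq_nonneg (‖f‖ - ‖x‖)]

theorem half_sq_norm_convex_combination_le {E : Type*} [NormedAddCommGroup E] [NormedSpace ℝ E]
    (x y : E) {α β : ℝ} (hα : 0 ≤ α) (hβ : 0 ≤ β) (hαβ : α + β = 1) :
    ‖α • x + β • y‖ ^ 2 / 2 ≤ α * (‖x‖ ^ 2 / 2) + β * (‖y‖ ^ 2 / 2) := by
  have h := ((convexOn_norm (convex_univ (𝕜 := ℝ) (E := E))).pow (fun _ _ => norm_nonneg _) 2).2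
    (Set.mem_univ x) (Set.mem_univ y) hα hβ hαβ
  simp only [Pi.pow_apply, smul_eq_mul] at h
  linarith

/-! ### Fenchel duality -/

namespace MultiOp

variable {X : Type*} [NormedAddCommGroup X] [NormedSpace ℝ X]

/-- The epigraph of the perturbation function of the problem of minimising
`F_A (x, f) + F_B (x, g) + ‖x‖² / 2 + ‖f + g‖² / 2`, where `F_A`, `F_B` are the Fitzpatrick
functions. -/
def perturbationEpigraph (A B : X → Set (StrongDual ℝ X)) :
    Set ((X × X × StrongDual ℝ X) × ℝ) :=
  {z | ∃ x f r y g s u w, (x, f, r) ∈ fitzpatrickEpigraph A ∧ (y, g, s) ∈ fitzpatrickEpigraph B ∧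
    z.1 = (x - y, x - u, f + g - w) ∧ r + s + ‖u‖ ^ 2 / 2 + ‖w‖ ^ 2 / 2 ≤ z.2}

theorem convex_perturbationEpigraph (A B : X → Set (StrongDual ℝ X)) :
    Convex ℝ (perturbationEpigraph A B) := by
  rintro ⟨_, t⟩ ⟨x, f, r, y, g, s, u, w, hA, hB, rfl, ht⟩
    ⟨_, t'⟩ ⟨x', f', r', y', g', s', u', w', hA', hB', rfl, ht'⟩ α β hα hβ hαβ
  refine ⟨_, _, _, _, _, _, α • u + β • u', α • w + β • w',
    convex_fitzpatrickEpigraph A hA hA' hα hβ hαβ, convex_fitzpatrickEpigraph B hB hB' hα hβ hαβ,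
    ?_, ?_⟩
  · simp only [Prod.smul_mk, Prod.mk_add_mk, Prod.mk.injEq]
    refine ⟨?_, ?_, ?_⟩ <;> module
  · have h1 := half_sq_norm_convex_combination_le u u' hα hβ hαβ
    have h2 := half_sq_norm_convex_combination_le w w' hα hβ hαβ
    have h3 := mul_le_mul_of_nonneg_left ht hα
    have h4 := mul_le_mul_of_nonneg_left ht' hβ
    simp only [Prod.smul_mk, Prod.mk_add_mk, smul_eq_mul] at h3 h4 ⊢
    linarith

theorem IsMaximalMonotone.nonneg_of_mem_perturbationEpigraph {A B : X → Set (StrongDual ℝ X)}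
    (hA : IsMaximalMonotone A) (hB : IsMaximalMonotone B) {t : ℝ}
    (h : (0, t) ∈ perturbationEpigraph A B) : 0 ≤ t := by
  obtain ⟨x, f, r, y, g, s, u, w, h1, h2, h3, h4⟩ := h
  simp only [Prod.ext_iff, Prod.fst_zero, Prod.snd_zero, eq_comm (a := (0 : X)),
    eq_comm (a := (0 : StrongDual ℝ X)), sub_eq_zero] at h3
  obtain ⟨rfl, rfl, rfl⟩ := h3
  have h5 := hA.apply_le_of_mem_fitzpatrickEpigraph h1
  have h6 := hB.apply_le_of_mem_fitzpatrickEpigraph h2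
  have h7 := (f + g).neg_half_sq_norm_add_le x
  rw [add_apply] at h7
  simp only at h4
  linarith

/-- A small perturbation is realised with the point of `A` fixed: only the point of `B` moves, to `a
- d`, and `u`, `w` adjust. Local boundedness of `B` keeps the cost uniformly bounded. -/
theorem exists_mem_interior_perturbationEpigraph [CompleteSpace X]
    {A B : X → Set (StrongDual ℝ X)} (hA : IsMonotone A) (hB : IsMonotone B)
    (hAB : (dom A ∩ interior (dom B)).Nonempty) :
    ∃ T : ℝ, (0, T) ∈ interior (perturbationEpigraph A B) := by
  obtain ⟨a, ⟨f, hf⟩, ha⟩ := hAB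
  obtain ⟨δ, hδ, M, hM⟩ := hB.exists_norm_le_of_mem_interior_dom ha
  obtain ⟨ε, hε, hball⟩ := Metric.mem_nhds_iff.1 (mem_interior_iff_mem_nhds.1 ha)
  let R : ℝ := f a + M * (‖a‖ + δ) + (‖a‖ + 1) ^ 2 / 2 + (‖f‖ + M + 1) ^ 2 / 2
  refine ⟨R + 1, mem_interior_iff_mem_nhds.2 (Metric.mem_nhds_iff.2
    ⟨min (min δ ε) 1, by positivity, ?_⟩)⟩
  rintro ⟨⟨d, e, k⟩, t⟩ hz
  rw [mem_ball_iff_norm] at hz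
  simp only [Prod.mk_sub_mk, sub_zero, Prod.norm_mk] at hz
  obtain ⟨h, ht⟩ := max_lt_iff.1 hz
  obtain ⟨hd, h⟩ := max_lt_iff.1 h
  obtain ⟨he, hk⟩ := max_lt_iff.1 h
  obtain ⟨⟨hdδ, hdε⟩, -⟩ := lt_min_iff.1 hd |>.imp_left lt_min_iff.1
  replace he := he.trans_le (min_le_right _ _)
  replace hk := hk.trans_le (min_le_right _ _)
  replace ht := ht.trans_le (min_le_right _ _)
  obtain ⟨g, hg⟩ : (B (a - d)).Nonempty := hball (by simpa [mem_ball_iff_norm] using hdε)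
  have hgM : ‖g‖ ≤ M := hM (a - d) (by simpa [mem_ball_iff_norm] using hdδ) g hg
  refine ⟨a, f, f a, a - d, g, g (a - d), a - e, f + g - k, hA.mem_fitzpatrickEpigraph hf,
    hB.mem_fitzpatrickEpigraph hg, by simp, ?_⟩
  have h1 : g (a - d) ≤ M * (‖a‖ + δ) := by
    refine (le_abs_self _).trans ((g.le_opNorm _).trans ?_)
    gcongr
    · exact (norm_nonneg _).trans hgM
    · exact (norm_sub_le _ _).trans (by gcongr)
  have h2 : ‖a - e‖ ≤ ‖a‖ + 1 := (norm_sub_le _ _).trans (by gcongr)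
  have h3 : ‖f + g - k‖ ≤ ‖f‖ + M + 1 :=
    (norm_sub_le _ _).trans (add_le_add ((norm_add_le _ _).trans (by gcongr)) hk.le)
  have h4 : ‖a - e‖ ^ 2 ≤ (‖a‖ + 1) ^ 2 := by gcongr
  have h5 : ‖f + g - k‖ ^ 2 ≤ (‖f‖ + M + 1) ^ 2 := by gcongr
  rw [Real.norm_eq_abs] at ht
  have h6 := (abs_lt.1 ht).1
  simp only [R] at h6 ⊢
  linarith

/-- In a reflexive space, under the interiority condition, `0` is in the range of `A + B + J`,
where `J` is the duality mapping. -/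
theorem IsMaximalMonotone.exists_mem_add_apply_eq [CompleteSpace X] (hX : IsReflexiveSpace X)
    {A B : X → Set (StrongDual ℝ X)} (hA : IsMaximalMonotone A) (hB : IsMaximalMonotone B)
    (hAB : (dom A ∩ interior (dom B)).Nonempty) :
    ∃ x, ∃ f ∈ A x, ∃ g ∈ B x, (f + g) x ≤ -(‖x‖ ^ 2 / 2 + ‖f + g‖ ^ 2 / 2) := by
  obtain ⟨T, hT⟩ := exists_mem_interior_perturbationEpigraph hA.1 hB.1 hAB
  obtain ⟨φ, hφ⟩ := (convex_perturbationEpigraph A B).exists_strongDual_add_nonneg hT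
    fun t => hA.nonneg_of_mem_perturbationEpigraph hB
  let q : StrongDual ℝ X := φ.comp (.inl ℝ X (X × StrongDual ℝ X))
  let p : StrongDual ℝ X :=
    φ.comp ((ContinuousLinearMap.inr ℝ X (X × StrongDual ℝ X)).comp (.inl ℝ X _))
  let P : StrongDual ℝ (StrongDual ℝ X) :=
    φ.comp ((ContinuousLinearMap.inr ℝ X (X × StrongDual ℝ X)).comp (.inr ℝ X _))
  have hdec : ∀ x y f, φ (x, y, f) = q x + p y + P f := by
    intro x y f
    simp only [q, p, P, ContinuousLinearMap.comp_apply, ← map_add]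
    simp
  obtain ⟨x, hx⟩ := hX (-P)
  have hPx : ∀ f : StrongDual ℝ X, P f = -f x := by
    intro f
    have := congrArg (fun F => F f) hx
    simp only [NormedSpace.dual_def, neg_apply] at this
    linarith
  have hxP : ‖x‖ = ‖P‖ := by
    rw [← norm_neg P, ← hx]
    exact ((NormedSpace.inclusionInDoubleDualLi ℝ).norm_map x).symm
  -- Evaluate the separation at graph points and take suprema over `u` and `w`.
  have key : ∀ a, ∀ f ∈ A a, ∀ b, ∀ g ∈ B b,
      ‖p‖ ^ 2 / 2 + ‖P‖ ^ 2 / 2 ≤ f a + g b + q (a - b) + p a + P (f + g) := by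
    intro a f hf b g hg
    rw [← le_sub_iff_add_le]
    refine p.half_sq_norm_le fun u => ?_
    rw [le_sub_comm]
    refine P.half_sq_norm_le fun w => ?_
    have := hφ (a - b, a - u, f + g - w) _ ⟨a, f, f a, b, g, g b, u, w,
      hA.1.mem_fitzpatrickEpigraph hf, hB.1.mem_fitzpatrickEpigraph hg, rfl, le_rfl⟩
    rw [hdec, map_sub p, map_sub P] at this
    linarith
  -- With `key`, these choices give `‖p‖² / 2 + ‖x‖² / 2 ≤ p x`, strictly if `-(q + p) ∉ A x` or `q
  -- ∉ B x`; the reverse inequality always holds.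
  obtain ⟨a, f, hf, h1, h1'⟩ := hA.exists_apply_le x (-(q + p))
  obtain ⟨b, g, hg, h2, h2'⟩ := hB.exists_apply_le x q
  have h3 := key a f hf b g hg
  have h4 := (-p).neg_half_sq_norm_add_le x
  rw [hPx, ← hxP] at h3
  rw [norm_neg] at h4
  simp only [map_sub, add_apply, neg_apply]
    at h1 h1' h2 h2' h3 h4
  have hsum : -(q + p) + q = -p := by abel
  refine ⟨x, -(q + p), ?_, q, ?_, ?_⟩
  · by_contra h
    have := h1' h
    linarith
  · by_contra h
    have := h2' h
    linarith
  · rw [hsum, norm_neg, neg_apply]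
    linarith

theorem IsMonotone.add {A B : X → Set (StrongDual ℝ X)} (hA : IsMonotone A) (hB : IsMonotone B) :
    IsMonotone (fun x => A x + B x) := by
  rintro x y _ ⟨f, hf, g, hg, rfl⟩ _ ⟨f', hf', g', hg', rfl⟩
  have := add_nonneg (hA x y f hf f' hf') (hB x y g hg g' hg')
  rwa [← add_apply, ← add_sub_add_comm] at this

/-- Maximal monotonicity is invariant under translations of the graph. -/
theorem IsMaximalMonotone.translate {T : X → Set (StrongDual ℝ X)} (hT : IsMaximalMonotone T)
    (z : X) (k : StrongDual ℝ X) : IsMaximalMonotone (fun x => {f | f + k ∈ T (x + z)}) := by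
  refine ⟨fun x y f hf g hg => ?_, fun w hw => ?_⟩
  · simpa using hT.1 _ _ _ hf _ hg
  · refine hT.2 (w.1 + z, w.2 + k) fun v hv => ?_
    have := hw (v.1 - z, v.2 - k) (by simpa [graph] using hv)
    rwa [sub_sub_eq_add_sub, sub_sub_eq_add_sub] at this

theorem dom_translate (T : X → Set (StrongDual ℝ X)) (z : X) (k : StrongDual ℝ X) :
    dom (fun x => {f | f + k ∈ T (x + z)}) = Homeomorph.addRight z ⁻¹' dom T := by
  ext x
  constructor
  · rintro ⟨f, hf⟩
    exact ⟨f + k, hf⟩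
  · rintro ⟨f, hf⟩
    exact ⟨f - k, by simpa using hf⟩

end MultiOp

theorem theorem1 {X : Type*} [NormedAddCommGroup X] [NormedSpace ℝ X] [CompleteSpace X]
    (hX : IsReflexiveSpace X)
    (A B : X → Set (StrongDual ℝ X))
    (hA : MultiOp.IsMaximalMonotone A) (hB : MultiOp.IsMaximalMonotone B)
    (hAB : (MultiOp.dom A ∩ interior (MultiOp.dom B)).Nonempty) :
    MultiOp.IsMaximalMonotone (fun x => A x + B x) := by
  refine ⟨hA.1.add hB.1, ?_⟩
  rintro ⟨z, k⟩ hz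
  obtain ⟨x, f, hf, g, hg, h⟩ :=
    (hA.translate z 0).exists_mem_add_apply_eq hX (hB.translate z k) (by
      obtain ⟨a, ha, hb⟩ := hAB
      refine ⟨a - z, ?_, ?_⟩
      · rw [MultiOp.dom_translate]
        simpa using ha
      · rw [MultiOp.dom_translate, ← Homeomorph.preimage_interior]
        simpa using hb)
  have h1 := hz (x + z, f + 0 + (g + k)) ⟨_, hf, _, hg, rfl⟩
  have h2 : k - (f + 0 + (g + k)) = -(f + g) := by abel
  have h3 : z - (x + z) = -x := by abel
  simp only [h2, h3, map_neg, neg_apply, neg_neg] at h1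
  have hx : x = 0 := by
    rw [← norm_eq_zero, ← sq_eq_zero_iff]
    nlinarith [sq_nonneg ‖x‖, sq_nonneg ‖f + g‖]
  have hfg : f + g = 0 := by
    rw [← norm_eq_zero, ← sq_eq_zero_iff]
    nlinarith [sq_nonneg ‖x‖, sq_nonneg ‖f + g‖]
  subst hx
  refine ⟨f + 0, by simpa using hf, g + k, by simpa using hg, ?_⟩
  change f + 0 + (g + k) = k
  rw [add_zero, ← add_assoc, hfg, zero_add]
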